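/- **Model.** An $n$-node network is a simple graph $G=(V,E)$ with $|V|=n$ whose nodes have unique identifiers of at most $c\lceil\log_2 n\rceil$ bits, where $c\ge 1$ is a fixed integer, and in which each node numbers its incident edges (its ports) arbitrarily. A deterministic CONGEST algorithm works on such networks in synchronous rounds. Initially each node knows $n$, its own identifier and its degree. In each round each node may send one message of $O(\log n)$ bits through each of its incident edges (more precisely, of at most $b\lceil\log_2 n\rceil$ bits, with a constant $b$ that does not depend on $n$ or on the network), receives the messages of its neighbours, and performs an arbitrary deterministic local computation, after which it may terminate; when a node terminates, it has to know which of its incident edges belong to the output. The round complexity $T(n)$ of the algorithm is the maximum, over all $n$-node networks, of the number of rounds until all nodes have terminated. A *2-ruling edge set* of $G$ is a set $R\subseteq E$ that is a $(2,2)$-ruling set of the line graph of $G$: any two distinct edges of $R$ are at distance at least $2$ in the line graph, and every edge of $E\setminus R$ is at distance at most $2$ in the line graph from some edge of $R$. Let $\log^* n$ be the number of times that $\log_2$ has to be applied to $n$ until the value is at most $1$. **Theorem.** For every integer $c\ge 1$ there is a deterministic CONGEST algorithm that computes a 2-ruling edge set of every network and has round complexity $\Theta(\log^* n)$ as $n\to\infty$.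 This is asymptotically optimal: every deterministic CONGEST algorithm that computes a 2-ruling edge set of every network has round complexity $\Omega(\log^* n)$. -/

import Mathlib

open Filter Asymptotics

/-- The iterated logarithm `log* n`: how often the base-two logarithm has to be applied to `n`
until the value is at most `1`. Rounding up after each application does not change this number,
since `clog 2 n ≤ m ↔ n ≤ 2 ^ m ↔ log₂ n ≤ m` for every natural number `m` and `n ≥ 1`. -/
def logStar (n : ℕ) : ℕ :=
  if 1 < n then logStar (Nat.clog 2 n) + 1 else 0
termination_by n
decreasing_by
  have h1 : n - 1 < 2 ^ (n - 1) := Nat.lt_two_pow_self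
  have h2 : Nat.clog 2 n ≤ n - 1 := Nat.clog_le_of_le_pow (by omega)
  omega

/-- `R` is an `(α, β)`-ruling set of `G`: any two distinct members are at distance at least `α`,
and every vertex outside `R` has a member of `R` within distance `β`. The distance is extended
(it is `⊤` between different connected components). -/
def IsRulingSet {V : Type*} (G : SimpleGraph V) (α β : ℕ) (R : Set V) : Prop :=
  (∀ u ∈ R, ∀ v ∈ R, u ≠ v → (α : ℕ∞) ≤ G.edist u v) ∧
    ∀ v, v ∉ R → ∃ u ∈ R, G.edist v u ≤ (β : ℕ∞)

/-- `R` is an `(α, β)`-ruling edge set of `G`: a ruling set of the line graph. -/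
def IsRulingEdgeSet {V : Type*} (G : SimpleGraph V) (α β : ℕ) (R : Set G.edgeSet) : Prop :=
  IsRulingSet G.lineGraph α β R

/-- An `n`-node network: a simple graph on `n` nodes, unique identifiers of at most
`c * ⌈log₂ n⌉` bits, and for each node an arbitrary numbering of its incident edges (its ports)
by `0, …, deg v - 1`. -/
structure Network (n c : ℕ) where
  graph : SimpleGraph (Fin n)
  id : Fin n → ℕ
  id_injective : Function.Injective id
  id_lt : ∀ v, id v < 2 ^ (c * Nat.clog 2 n)
  deg : Fin n → ℕ
  port : ∀ v, Fin (deg v) ≃ graph.neighborSet v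

namespace Network

variable {n c : ℕ} (N : Network n c)

/-- The neighbour of `v` behind port `i`. -/
def nbr (v : Fin n) (i : Fin (N.deg v)) : Fin n := (N.port v i).1

theorem adj_nbr (v : Fin n) (i : Fin (N.deg v)) : N.graph.Adj v (N.nbr v i) := (N.port v i).2

/-- The port at which the neighbour of `v` behind port `i` sees `v`. -/
def backPort (v : Fin n) (i : Fin (N.deg v)) : Fin (N.deg (N.nbr v i)) :=
  (N.port (N.nbr v i)).symm ⟨v, (N.adj_nbr v i).symm⟩

/-- The edge at port `i` of `v`. -/
def edge (v : Fin n) (i : Fin (N.deg v)) : N.graph.edgeSet :=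
  ⟨s(v, N.nbr v i), (SimpleGraph.mem_edgeSet N.graph).2 (N.adj_nbr v i)⟩

end Network

/-- A deterministic synchronous message passing algorithm whose output is a set of edges. The
local state of a node of degree `d` lies in `State d`; initially the node knows the number `n` of
nodes, its identifier, and its degree. In every round it sends a bit string through each of its
ports, receives one through each port, and updates its state by an arbitrary local computation.
It runs as long as `output` is `none`, and it terminates with output `some o` where `o i` says
whether the edge at its port `i` is selected. -/
structure DistAlgorithm where
  State : ℕ → Type
  init : (n id d : ℕ) → State d
  send : {d : ℕ} → State d → Fin d → List Bool
  receive : {d : ℕ} → State d → (Fin d → List Bool) → State d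
  output : {d : ℕ} → State d → Option (Fin d → Bool)

namespace DistAlgorithm

variable (A : DistAlgorithm)

/-- The message that a node in state `s` sends through port `i`. The empty string means that
nothing is sent; a terminated node sends nothing. -/
def message {d : ℕ} (s : A.State d) (i : Fin d) : List Bool :=
  if (A.output s).isSome then [] else A.send s i

/-- The state after a round in which `m i` is received at port `i`. A terminated node does not
change its state (nor its output) any more. -/
def update {d : ℕ} (s : A.State d) (m : Fin d → List Bool) : A.State d :=
  if (A.output s).isSome then s else A.receive s m

/-- The state of each node after `t` rounds on the network `N`. -/
def exec {n c : ℕ} (N : Network n c) : ℕ → (v : Fin n) → A.State (N.deg v)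
  | 0, v => A.init n (N.id v) (N.deg v)
  | t + 1, v => A.update (exec N t v)
      (fun i => A.message (exec N t (N.nbr v i)) (N.backPort v i))

/-- All nodes have terminated after at most `t` rounds. -/
def HaltsBy {n c : ℕ} (N : Network n c) (t : ℕ) : Prop :=
  ∀ v, (A.output (A.exec N t v)).isSome

/-- `A` is a CONGEST algorithm on networks with `c * ⌈log₂ n⌉`-bit identifiers: all messages
that are ever sent have `O(log n)` bits. -/
def IsCongest (c : ℕ) : Prop :=
  ∃ b : ℕ, ∀ (n : ℕ) (N : Network n c) (t : ℕ) (v : Fin n) (i : Fin (N.deg v)),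
    (A.message (A.exec N t v) i).length ≤ b * Nat.clog 2 n

/-- On every network, all nodes terminate, and their outputs describe (consistently at both
endpoints of each edge) an `(α, β)`-ruling edge set. -/
def ComputesRulingEdgeSet (c α β : ℕ) : Prop :=
  ∀ (n : ℕ) (N : Network n c), ∃ (t : ℕ) (R : Set N.graph.edgeSet),
    IsRulingEdgeSet N.graph α β R ∧
      ∀ v, ∃ o, A.output (A.exec N t v) = some o ∧ ∀ i, o i = true ↔ N.edge v i ∈ R

/-- `T n` is the worst-case round complexity of `A` on `n`-node networks: the least `t` such that
`A` terminates within `t` rounds on all of them. -/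
def HasRoundComplexity (c : ℕ) (T : ℕ → ℕ) : Prop :=
  ∀ n, IsLeast {t | ∀ N : Network n c, A.HaltsBy N t} (T n)

end DistAlgorithm

/-!
*Upper bound.* Each node of positive degree points to its parent, the neighbour behind port `0`.
The pointers form a subgraph in which each non-isolated node lies on an edge, so a maximal matching
of this subgraph is a 2-ruling edge set of the whole graph: an edge at `u` is adjacent to the edge
from `u` to its parent, and that edge contains a matched node (`isRulingEdgeSet_of_matching`).
A maximal matching is found quickly because every node has only one parent. Cole and Vishkin's
colour reduction along the pointers leads from the identifiers to `32 c + 1` colours in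
`logStar n` rounds (`RulingAlgorithm.color_logStar_lt`): the `t`-th iterate `a` of `⌈log₂ ·⌉` at `n`
bounds the colours after `t ≥ 1` rounds by `16 c (a + 1)`. Then the colours are treated one after
the other: each unmatched node of the current colour is matched with one of its unmatched children.
No conflicts arise, as a node and its parent have different colours (`matching_phase`).
The messages are single bits or colours, and the latter never exceed the range of the identifiers.

*Lower bound.* On a cycle, whether a node selects the edge to its successor after `t` rounds depends
on the `2 t + 1` identifiers around it. A 2-ruling edge set of a cycle contains no two
consecutive edges but one of any five consecutive ones, so the decisions of five consecutive nodes
cannot stay the same when the five nodes are shifted by one. They form a proper colouring with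
`2 ^ 5` colours of the shift graph on the increasing `(2 t + 5)`-tuples of identifiers
(`DistAlgorithm.isShiftColoring_selectsSucc`). A colouring of `(k + 2)`-tuples with `q` colours
yields one of `(k + 1)`-tuples with `2 ^ q` colours (`IsShiftColoring.reduce`), and `1`-tuples need
`n` colours; hence `logStar n` is at most `2 t + O(1)`.
-/

/-! ### The iterated logarithm -/

theorem logStar_of_one_lt {n : ℕ} (hn : 1 < n) : logStar n = logStar (Nat.clog 2 n) + 1 := by
  rw [logStar, if_pos hn]

theorem logStar_of_le_one {n : ℕ} (hn : n ≤ 1) : logStar n = 0 := by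
  rw [logStar, if_neg (by omega)]

theorem clog_two_lt_self {n : ℕ} (hn : 1 ≤ n) : Nat.clog 2 n < n := by
  have h1 : n - 1 < 2 ^ (n - 1) := Nat.lt_two_pow_self
  have h2 : Nat.clog 2 n ≤ n - 1 := Nat.clog_le_of_le_pow (by omega)
  omega

theorem logStar_mono : Monotone logStar := by
  intro m n h
  induction n using Nat.strong_induction_on generalizing m with
  | _ n ih =>
    rcases Nat.lt_or_ge 1 m with hm | hm
    · rw [logStar_of_one_lt hm, logStar_of_one_lt (hm.trans_le h)]
      exact Nat.succ_le_succ (ih _ (clog_two_lt_self (by omega)) (Nat.clog_mono_right 2 h))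
    · rw [logStar_of_le_one hm]
      exact Nat.zero_le _

theorem logStar_two_pow {q : ℕ} (hq : 1 ≤ q) : logStar (2 ^ q) = logStar q + 1 := by
  rw [logStar_of_one_lt (Nat.one_lt_two_pow (by omega)), Nat.clog_pow 2 q (by omega)]

theorem logStar_le_self (n : ℕ) : logStar n ≤ n := by
  induction n using Nat.strong_induction_on with
  | _ n ih =>
    rcases Nat.lt_or_ge 1 n with hn | hn
    · have h := clog_two_lt_self hn.le
      have := ih _ h
      rw [logStar_of_one_lt hn]
      omega
    · rw [logStar_of_le_one hn]
      exact Nat.zero_le _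

theorem tendsto_logStar : Tendsto logStar atTop atTop := by
  refine tendsto_atTop_atTop_of_monotone logStar_mono fun k => ?_
  suffices h : ∃ n, 1 ≤ n ∧ k ≤ logStar n from ⟨h.choose, h.choose_spec.2⟩
  induction k with
  | zero => exact ⟨1, le_rfl, Nat.zero_le _⟩
  | succ k ih =>
    obtain ⟨n, hn, hk⟩ := ih
    exact ⟨2 ^ n, Nat.one_le_two_pow, by rw [logStar_two_pow hn]; omega⟩

theorem clog_iterate_logStar_le_one (n : ℕ) : (Nat.clog 2)^[logStar n] n ≤ 1 := by
  induction n using Nat.strong_induction_on with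
  | _ n ih =>
    rcases Nat.lt_or_ge 1 n with hn | hn
    · rw [logStar_of_one_lt hn, Function.iterate_succ_apply]
      exact ih _ (clog_two_lt_self hn.le)
    · rwa [logStar_of_le_one hn]

/-! ### Colourings of the shift graph -/

/-- `f` properly colours the shift graph on the increasing `(k + 1)`-tuples of numbers below `n`:
the tuples `(x₀, …, x_k)` and `(x₁, …, x_{k+1})` get different colours. Tuples are encoded as
lists, and the values of `f` on other lists are irrelevant. -/
def IsShiftColoring {C : Type*} (n k : ℕ) (f : List ℕ → C) : Prop :=
  ∀ (a b : ℕ) (l : List ℕ), l.length = k → (a :: (l ++ [b])).SortedLT →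
    (∀ x ∈ a :: (l ++ [b]), x < n) → f (a :: l) ≠ f (l ++ [b])

/-- Replacing the colour of a tuple by the set of the colours of its extensions to the left
shortens the tuples by one entry. -/
theorem IsShiftColoring.reduce {C : Type*} {n k : ℕ} {f : List ℕ → C}
    (hf : IsShiftColoring n (k + 1) f) :
    IsShiftColoring n k fun l => {γ | ∃ a < n, (a :: l).SortedLT ∧ f (a :: l) = γ} := by
  intro a b l hl hs hn heq
  have hpre : (a :: l).SortedLT := by
    have : (a :: l).Sublist (a :: (l ++ [b])) := (List.sublist_append_left l [b]).cons_cons a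
    exact (hs.pairwise.sublist this).sortedLT
  have hmem : f (a :: (l ++ [b])) ∈ {γ | ∃ a' < n, (a' :: (l ++ [b])).SortedLT ∧
      f (a' :: (l ++ [b])) = γ} := ⟨a, hn a (by simp), hs, rfl⟩
  simp only at heq
  rw [← heq] at hmem
  obtain ⟨a', ha', hs', hc⟩ := hmem
  have hs2 : (a' :: ((a :: l) ++ [b])).SortedLT := by
    have h1 := hs'.pairwise
    have h2 := hs.pairwise
    refine List.Pairwise.sortedLT ?_
    rw [List.cons_append]
    rw [List.pairwise_cons] at h1 ⊢
    refine ⟨fun x hx => ?_, h2⟩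
    have haa : a' < a := h1.1 a (by simp)
    rcases List.mem_cons.1 hx with rfl | hx'
    · exact haa
    · exact haa.trans ((List.pairwise_cons.1 h2).1 x hx')
  refine hf a' b (a :: l) (by simp [hl]) hs2 (fun x hx => ?_) hc
  rcases List.mem_cons.1 hx with rfl | hx'
  · exact ha'
  · exact hn x (by simpa using hx')

/-- A colouring of the shift graph with few colours exists only for short tuples or small `n`. -/
theorem IsShiftColoring.logStar_le {k : ℕ} : ∀ {C : Type} [Fintype C] {n : ℕ} {f : List ℕ → C},
    IsShiftColoring n k f → 1 ≤ Fintype.card C → logStar n ≤ k + logStar (Fintype.card C) := by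
  induction k with
  | zero =>
    intro C _ n f hf _
    have hinj : Function.Injective fun i : Fin n => f [i.1] := by
      have key : ∀ i j : Fin n, i < j → f [i.1] ≠ f [j.1] := fun i j hij =>
        hf i j [] rfl (by simpa [List.sortedLT_iff_pairwise] using hij) (by simp)
      intro i j hij
      rcases lt_trichotomy i j with h | h | h
      · exact absurd hij (key i j h)
      · exact h
      · exact absurd hij.symm (key j i h)
    have := Fintype.card_le_of_injective _ hinj
    rw [Fintype.card_fin] at this
    rw [Nat.zero_add]
    exact logStar_mono this
  | succ k ih =>
    intro C _ n f hf hC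
    classical
    have h := ih hf.reduce (by rw [Fintype.card_set]; exact Nat.one_le_two_pow)
    rw [Fintype.card_set, logStar_two_pow hC] at h
    omega

/-! ### Generalities on executions and ruling sets -/

namespace DistAlgorithm

variable (A : DistAlgorithm)

theorem exec_succ_of_isSome {n c : ℕ} (N : Network n c) {t : ℕ} {v : Fin n}
    (h : (A.output (A.exec N t v)).isSome) : A.exec N (t + 1) v = A.exec N t v := by
  rw [exec, update, if_pos h]

theorem exec_add_of_isSome {n c : ℕ} (N : Network n c) {t : ℕ} {v : Fin n}
    (h : (A.output (A.exec N t v)).isSome) (s : ℕ) : A.exec N (t + s) v = A.exec N t v := by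
  induction s with
  | zero => rfl
  | succ s ih => rw [← Nat.add_assoc, A.exec_succ_of_isSome N (by rw [ih]; exact h), ih]

/-- Two terminated states of a node are the same. -/
theorem exec_eq_of_isSome {n c : ℕ} (N : Network n c) {t t' : ℕ} {v : Fin n}
    (h : (A.output (A.exec N t v)).isSome) (h' : (A.output (A.exec N t' v)).isSome) :
    A.exec N t v = A.exec N t' v := by
  rw [← A.exec_add_of_isSome N h t', ← A.exec_add_of_isSome N h' t, Nat.add_comm]

end DistAlgorithm

theorem SimpleGraph.edist_le_two_cases {V : Type*} {G : SimpleGraph V} {u v : V}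
    (h : G.edist u v ≤ (2 : ℕ)) : u = v ∨ G.Adj u v ∨ ∃ w, G.Adj u w ∧ G.Adj w v := by
  obtain ⟨p, hp⟩ := SimpleGraph.exists_walk_of_edist_ne_top
    (ne_top_of_le_ne_top (ENat.natCast_ne_top 2) h)
  rw [← hp] at h
  have h2 : p.length ≤ 2 := by exact_mod_cast h
  cases p with
  | nil => exact Or.inl rfl
  | cons h1 q =>
    cases q with
    | nil => exact Or.inr (Or.inl h1)
    | cons h3 r =>
      cases r with
      | nil => exact Or.inr (Or.inr ⟨_, h1, h3⟩)
      | cons h4 r' =>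
        simp only [SimpleGraph.Walk.length_cons] at h2
        omega

theorem SimpleGraph.edist_lineGraph_le_one {V : Type*} {G : SimpleGraph V} {e f : G.edgeSet}
    {x : V} (he : x ∈ e.1) (hf : x ∈ f.1) : G.lineGraph.edist e f ≤ 1 := by
  by_cases h : e = f
  · rw [SimpleGraph.edist_eq_zero_iff.2 h]
    exact zero_le_one
  · exact (SimpleGraph.edist_eq_one_iff_adj.2
      (SimpleGraph.lineGraph_adj_iff_exists.2 ⟨h, x, he, hf⟩)).le

/-! ### Executions on cycles -/

section Cycle

open scoped Fin.CommRing

theorem Fin.sub_one_ne_add_one {m : ℕ} (v : Fin (m + 3)) : v - 1 ≠ v + 1 := by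
  intro h
  have h3 : (1 + 1 : Fin (m + 3)) = 0 := by linear_combination -h
  rw [Fin.ext_iff, Fin.val_add, Fin.val_one, Fin.val_zero, Nat.mod_eq_of_lt (by omega)] at h3
  omega

/-- The cycle with at least three nodes and the given identifiers. Port `0` of each node leads to
its predecessor and port `1` to its successor. -/
noncomputable def cycleNetwork {m c : ℕ} (x : Fin (m + 3) → ℕ) (hx : Function.Injective x)
    (hlt : ∀ v, x v < 2 ^ (c * Nat.clog 2 (m + 3))) : Network (m + 3) c where
  graph := SimpleGraph.cycleGraph (m + 3)
  id := x
  id_injective := hx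
  id_lt := hlt
  deg _ := 2
  port v := Equiv.ofBijective
    (fun i => if i = 0 then
        ⟨v - 1, SimpleGraph.cycleGraph_adj.2 (Or.inl (sub_sub_cancel v 1))⟩
      else ⟨v + 1, SimpleGraph.cycleGraph_adj.2 (Or.inr (add_sub_cancel_left v 1))⟩) <| by
    have h2 : v - 1 ≠ v + 1 := Fin.sub_one_ne_add_one v
    constructor
    · intro i j hij
      fin_cases i <;> fin_cases j
      · rfl
      · exact absurd (congrArg Subtype.val hij) h2
      · exact absurd (congrArg Subtype.val hij).symm h2
      · rfl
    · rintro ⟨w, hw⟩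
      rcases SimpleGraph.cycleGraph_adj.1 hw with h | h
      · exact ⟨0, Subtype.ext (show v - 1 = w by linear_combination h)⟩
      · exact ⟨1, Subtype.ext (show v + 1 = w by linear_combination -h)⟩

namespace DistAlgorithm

variable (A : DistAlgorithm)

/-- The state after `t` rounds of the node at position `j` of a bi-infinite path with the
identifiers `x`, whose nodes believe to live in an `n`-node network. -/
def lineExec (n : ℕ) (x : ℤ → ℕ) : ℕ → ℤ → A.State 2
  | 0, j => A.init n (x j) 2
  | t + 1, j => A.update (lineExec n x t j) fun i =>
      if i = 0 then A.message (lineExec n x t (j - 1)) 1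
      else A.message (lineExec n x t (j + 1)) 0

/-- After `t` rounds, a node only depends on the identifiers within distance `t`. -/
theorem lineExec_congr (n : ℕ) {x y : ℤ → ℕ} (t : ℕ) {j k : ℤ}
    (h : ∀ i : ℤ, -t ≤ i → i ≤ t → x (j + i) = y (k + i)) :
    A.lineExec n x t j = A.lineExec n y t k := by
  induction t generalizing j k with
  | zero =>
    have := h 0 (by simp) (by simp)
    rw [add_zero, add_zero] at this
    rw [lineExec, lineExec, this]
  | succ t ih =>
    rw [lineExec, lineExec, ih fun i h1 h2 => h i (by push_cast; omega) (by push_cast; omega),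
      ih (j := j - 1) (k := k - 1) fun i h1 h2 => by
        have := h (i - 1) (by push_cast; omega) (by push_cast; omega)
        rwa [show j + (i - 1) = j - 1 + i by ring, show k + (i - 1) = k - 1 + i by ring] at this,
      ih (j := j + 1) (k := k + 1) fun i h1 h2 => by
        have := h (i + 1) (by push_cast; omega) (by push_cast; omega)
        rwa [show j + (i + 1) = j + 1 + i by ring, show k + (i + 1) = k + 1 + i by ring] at this]

theorem exec_cycleNetwork {m c : ℕ} (x : Fin (m + 3) → ℕ) (hx : Function.Injective x)
    (hlt : ∀ v, x v < 2 ^ (c * Nat.clog 2 (m + 3))) (t : ℕ) (j : ℤ) :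
    A.exec (cycleNetwork x hx hlt) t (j : Fin (m + 3)) =
      A.lineExec (m + 3) (fun i => x (i : Fin (m + 3))) t j := by
  induction t generalizing j with
  | zero => rfl
  | succ t ih =>
    have hp := ih (j - 1)
    have hs := ih (j + 1)
    rw [Int.cast_sub, Int.cast_one] at hp
    rw [Int.cast_add, Int.cast_one] at hs
    rw [exec, lineExec, ih j]
    refine congrArg (A.update _) (funext fun i => ?_)
    have hcases : ∀ k : Fin 2, k = 0 ∨ k = 1 := by decide
    rcases hcases i with rfl | rfl
    · have hb : (cycleNetwork x hx hlt).backPort (j : Fin (m + 3)) (0 : Fin 2) = (1 : Fin 2) :=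
        (Equiv.symm_apply_eq _).2 (Subtype.ext (sub_add_cancel (j : Fin (m + 3)) 1).symm)
      rw [hb, if_pos rfl, ← hp]
      rfl
    · have hb : (cycleNetwork x hx hlt).backPort (j : Fin (m + 3)) (1 : Fin 2) = (0 : Fin 2) :=
        (Equiv.symm_apply_eq _).2 (Subtype.ext (add_sub_cancel_right (j : Fin (m + 3)) 1).symm)
      rw [hb, if_neg one_ne_zero, ← hs]
      rfl

end DistAlgorithm

/-- The edge from `v` to its successor. -/
noncomputable def cycleEdge {m : ℕ} (v : Fin (m + 3)) : (SimpleGraph.cycleGraph (m + 3)).edgeSet :=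
  ⟨s(v, v + 1), SimpleGraph.cycleGraph_adj.2 (Or.inr (add_sub_cancel_left v 1))⟩

theorem cycleEdge_ne_succ {m : ℕ} (v : Fin (m + 3)) : cycleEdge v ≠ cycleEdge (v + 1) := by
  intro h
  rcases Sym2.eq_iff.1 (congrArg Subtype.val h) with ⟨h1, -⟩ | ⟨h1, -⟩
  · exact one_ne_zero (α := Fin (m + 3)) (by linear_combination -h1)
  · have := Fin.sub_one_ne_add_one (v + 1)
    exact this (by linear_combination h1)

theorem cycleEdge_surjective {m : ℕ} (e : (SimpleGraph.cycleGraph (m + 3)).edgeSet) :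
    ∃ v, e = cycleEdge v := by
  obtain ⟨e, he⟩ := e
  induction e using Sym2.ind with
  | _ u v =>
    rcases SimpleGraph.cycleGraph_adj.1 he with h | h
    · obtain rfl : u = v + 1 := by linear_combination h
      exact ⟨v, Subtype.ext Sym2.eq_swap⟩
    · obtain rfl : v = u + 1 := by linear_combination h
      exact ⟨u, rfl⟩

theorem lineGraph_cycleGraph_adj {m : ℕ} {u v : Fin (m + 3)}
    (h : (SimpleGraph.cycleGraph (m + 3)).lineGraph.Adj (cycleEdge u) (cycleEdge v)) :
    v = u + 1 ∨ v = u - 1 := by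
  obtain ⟨hne, x, hu, hv⟩ := SimpleGraph.lineGraph_adj_iff_exists.1 h
  have huv : u ≠ v := fun h => hne (congrArg cycleEdge h)
  rcases Sym2.mem_iff.1 hu with rfl | rfl <;> rcases Sym2.mem_iff.1 hv with h | h
  · exact absurd h huv
  · right
    linear_combination -h
  · left
    exact h.symm
  · exact absurd (add_right_cancel h) huv

/-- A 2-ruling edge set of a cycle contains no two consecutive edges, but one of any five
consecutive edges. -/
theorem IsRulingEdgeSet.cycle {m : ℕ} {R : Set (SimpleGraph.cycleGraph (m + 3)).edgeSet}
    (hR : IsRulingEdgeSet (SimpleGraph.cycleGraph (m + 3)) 2 2 R) (v : Fin (m + 3)) :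
    (cycleEdge v ∈ R → cycleEdge (v + 1) ∉ R) ∧
      (cycleEdge v ∈ R ∨ cycleEdge (v + 1) ∈ R ∨ cycleEdge (v - 1) ∈ R ∨
        cycleEdge (v + 2) ∈ R ∨ cycleEdge (v - 2) ∈ R) := by
  constructor
  · intro h1 h2
    have h3 := hR.1 _ h1 _ h2 (cycleEdge_ne_succ v)
    have h4 := SimpleGraph.edist_lineGraph_le_one (e := cycleEdge v) (f := cycleEdge (v + 1))
      (Sym2.mem_mk_right v (v + 1)) (Sym2.mem_mk_left (v + 1) (v + 1 + 1))
    have h5 : ((2 : ℕ) : ℕ∞) ≤ (1 : ℕ) := h3.trans h4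
    have h6 : 2 ≤ 1 := by exact_mod_cast h5
    omega
  · by_cases hv : cycleEdge v ∈ R
    · exact Or.inl hv
    obtain ⟨f, hf, hd⟩ := hR.2 _ hv
    obtain ⟨w, rfl⟩ := cycleEdge_surjective f
    rcases SimpleGraph.edist_le_two_cases hd with h | h | ⟨e, h1, h2⟩
    · exact absurd (h ▸ hf) hv
    · rcases lineGraph_cycleGraph_adj h with rfl | rfl <;> tauto
    · obtain ⟨u, rfl⟩ := cycleEdge_surjective e
      have e1 : v + 1 + 1 = v + 2 := by ring
      have e2 : v - 1 - 1 = v - 2 := by ring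
      rcases lineGraph_cycleGraph_adj h1 with rfl | rfl <;>
        rcases lineGraph_cycleGraph_adj h2 with rfl | rfl
      · rw [e1] at hf
        tauto
      · rw [add_sub_cancel_right] at hf
        exact absurd hf hv
      · rw [sub_add_cancel] at hf
        exact absurd hf hv
      · rw [e2] at hf
        tauto

namespace DistAlgorithm

variable (A : DistAlgorithm)

/-- Whether a terminated node of a cycle selects the edge to its successor. -/
def selectsSucc (s : A.State 2) : Prop := ∃ o, A.output s = some o ∧ o 1 = true

theorem selectsSucc_cycle {m c : ℕ} (hA : A.ComputesRulingEdgeSet c 2 2)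
    (x : Fin (m + 3) → ℕ) (hx : Function.Injective x)
    (hlt : ∀ v, x v < 2 ^ (c * Nat.clog 2 (m + 3))) {t : ℕ}
    (ht : A.HaltsBy (cycleNetwork x hx hlt) t) :
    ∃ R, IsRulingEdgeSet (SimpleGraph.cycleGraph (m + 3)) 2 2 R ∧ ∀ j : ℤ,
      A.selectsSucc (A.lineExec (m + 3) (fun i => x (i : Fin (m + 3))) t j) ↔
        cycleEdge (j : Fin (m + 3)) ∈ R := by
  obtain ⟨t', R, hR, ho⟩ := hA _ (cycleNetwork x hx hlt)
  refine ⟨R, hR, fun j => ?_⟩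
  obtain ⟨o, ho1, ho2⟩ := ho (j : Fin (m + 3))
  have he := A.exec_eq_of_isSome _ (ht (j : Fin (m + 3))) (by rw [ho1]; rfl)
  rw [← he, A.exec_cycleNetwork] at ho1
  have h2 := ho2 (1 : Fin 2)
  have hE : (cycleNetwork x hx hlt).edge (j : Fin (m + 3)) (1 : Fin 2) =
    cycleEdge (j : Fin (m + 3)) := rfl
  rw [hE] at h2
  refine Iff.trans ?_ h2
  constructor
  · rintro ⟨o', h1, h3⟩
    obtain rfl : o = o' := Option.some.inj (ho1.symm.trans h1)
    exact h3
  · exact fun h => ⟨o, ho1, h⟩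

/-- Distinct identifiers below `n` can be placed on consecutive nodes of an `n`-cycle. -/
theorem exists_cycle_ids {m : ℕ} {l : List ℕ} (hl : l.Nodup) (hlen : l.length ≤ m + 3)
    (hlt : ∀ x ∈ l, x < m + 3) : ∃ x : Fin (m + 3) → ℕ, Function.Injective x ∧
      (∀ v, x v < m + 3) ∧ ∀ j : ℕ, j < l.length → x ((j : ℤ) : Fin (m + 3)) = l.getD j 0 := by
  obtain ⟨g, hg⟩ := Finset.exists_equiv_extend_of_card_eq (α := Fin (m + 3)) (β := ℕ)
    (t := Finset.range (m + 3)) (by simp) (s := Finset.univ.filter fun v => v.1 < l.length)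
    (f := fun v => l.getD v.1 0) (by
      intro y hy
      obtain ⟨v, hv, rfl⟩ := Finset.mem_image.1 hy
      have hv' : v.1 < l.length := by simpa using hv
      rw [Finset.mem_range, List.getD_eq_getElem _ _ hv']
      exact hlt _ (List.getElem_mem hv')) (by
      intro u hu v hv huv
      have hu' : u.1 < l.length := by simpa using hu
      have hv' : v.1 < l.length := by simpa using hv
      simp only [List.getD_eq_getElem _ _ hu', List.getD_eq_getElem _ _ hv'] at huv
      exact Fin.ext ((hl.getElem_inj_iff).1 huv))
  refine ⟨fun v => (g v).1, fun u v h => g.injective (Subtype.ext h),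
    fun v => Finset.mem_range.1 (g v).2, fun j hj => ?_⟩
  have hv : ((j : ℤ) : Fin (m + 3)).1 = j := by
    rw [Int.cast_natCast, Fin.val_natCast, Nat.mod_eq_of_lt (by omega)]
  have := hg ((j : ℤ) : Fin (m + 3)) (by simp only [Finset.mem_filter, hv]; simpa using hj)
  simp only [hv] at this
  exact this

/-- The decisions of five consecutive nodes, as a function of the identifiers within distance `t`
of them, properly colour the shift graph. -/
theorem isShiftColoring_selectsSucc {m c : ℕ} (hc : 1 ≤ c) (hA : A.ComputesRulingEdgeSet c 2 2)
    {t : ℕ} (ht : ∀ N : Network (m + 3) c, A.HaltsBy N t) (hm : 2 * t + 6 ≤ m + 3) :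
    IsShiftColoring (m + 3) (2 * t + 4) fun l => {i : Fin 5 |
      A.selectsSucc (A.lineExec (m + 3) (fun j => l.getD j.toNat 0) t (t + i.1))} := by
  intro a b l hl hs hlt heq
  obtain ⟨x, hx, hxlt, hxl⟩ := exists_cycle_ids (m := m) hs.pairwise.nodup
    (by simp [hl]; omega) hlt
  have hpow : m + 3 ≤ 2 ^ (c * Nat.clog 2 (m + 3)) :=
    (Nat.le_pow_clog one_lt_two _).trans (Nat.pow_le_pow_right two_pos (Nat.le_mul_of_pos_left _ hc))
  obtain ⟨R, hR, hsel⟩ := A.selectsSucc_cycle hA x hx (fun v => (hxlt v).trans_le hpow) (ht _)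
  -- position `j` of the list carries the identifier of node `j`
  have hleft : ∀ i : ℕ, i < 5 → (A.selectsSucc
      (A.lineExec (m + 3) (fun j => (a :: l).getD j.toNat 0) t (t + i)) ↔
      cycleEdge ((t + i : ℤ) : Fin (m + 3)) ∈ R) := by
    intro i hi
    rw [← hsel, A.lineExec_congr (m + 3) t (y := fun i => x (i : Fin (m + 3))) (k := t + i)]
    intro d h1 h2
    obtain ⟨k, hk⟩ := Int.eq_ofNat_of_zero_le (a := t + i + d) (by omega)
    have hkl : k < (a :: l).length := by simp only [List.length_cons]; omega
    rw [hk, hxl k (by simp only [List.length_cons, List.length_append] at hkl ⊢; omega),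
      ← List.cons_append, List.getD_append _ _ _ _ hkl]
    rfl
  have hright : ∀ i : ℕ, i < 5 → (A.selectsSucc
      (A.lineExec (m + 3) (fun j => (l ++ [b]).getD j.toNat 0) t (t + i)) ↔
      cycleEdge ((t + i + 1 : ℤ) : Fin (m + 3)) ∈ R) := by
    intro i hi
    rw [← hsel, A.lineExec_congr (m + 3) t (y := fun i => x (i : Fin (m + 3))) (k := t + i + 1)]
    intro d h1 h2
    obtain ⟨k, hk⟩ := Int.eq_ofNat_of_zero_le (a := t + i + d) (by omega)
    rw [hk, show (t + i + 1 + d : ℤ) = ((k + 1 : ℕ) : ℤ) by push_cast; omega,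
      hxl (k + 1) (by simp only [List.length_cons, List.length_append]; simp; omega),
      List.getD_cons_succ]
    rfl
  have hstep : ∀ i : ℕ, i < 5 → (cycleEdge ((t + i : ℤ) : Fin (m + 3)) ∈ R ↔
      cycleEdge ((t + i + 1 : ℤ) : Fin (m + 3)) ∈ R) := by
    intro i hi
    rw [← hleft i hi, ← hright i hi]
    exact Set.ext_iff.1 heq ⟨i, hi⟩
  obtain ⟨h1, h2⟩ := hR.cycle ((t + 2 : ℤ) : Fin (m + 3))
  have s0 := hstep 0 (by omega)
  have s1 := hstep 1 (by omega)
  have s2 := hstep 2 (by omega)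
  have s3 := hstep 3 (by omega)
  push_cast at s0 s1 s2 s3 h1 h2
  have e1 : (t + 1 + 1 : Fin (m + 3)) = t + 2 := by ring
  have e2 : (t + 2 + 2 : Fin (m + 3)) = t + 3 + 1 := by ring
  have e3 : (t + 2 - 1 : Fin (m + 3)) = t + 1 := by ring
  have e4 : (t + 2 - 2 : Fin (m + 3)) = t := by ring
  have e5 : (t + 2 + 1 : Fin (m + 3)) = t + 3 := by ring
  rw [add_zero] at s0
  rw [e1] at s1
  rw [e5] at s2 h1 h2
  rw [e2, e3, e4] at h2
  have n2 : cycleEdge (t + 2 : Fin (m + 3)) ∉ R := fun h => h1 h (s2.1 h)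
  have n1 := fun h => n2 (s1.1 h)
  rcases h2 with h | h | h | h | h
  · exact n2 h
  · exact n2 (s2.2 h)
  · exact n1 h
  · exact n2 (s2.2 (s3.2 h))
  · exact n1 (s0.1 h)

/-- Linial's lower bound for 2-ruling edge sets. -/
theorem logStar_le_of_haltsBy {n c : ℕ} (hc : 1 ≤ c) (hA : A.ComputesRulingEdgeSet c 2 2)
    {t : ℕ} (ht : ∀ N : Network n c, A.HaltsBy N t) : logStar n ≤ 2 * t + 9 := by
  -- a cycle must be long enough for `2 t + 6` distinct identifiers
  rcases Nat.lt_or_ge n (2 * t + 6) with h | h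
  · exact (logStar_le_self n).trans (by omega)
  · obtain ⟨m, rfl⟩ := Nat.exists_eq_add_of_le' (show 3 ≤ n by omega)
    have key := (A.isShiftColoring_selectsSucc hc hA ht h).logStar_le
      (by rw [Fintype.card_set]; exact Nat.one_le_two_pow)
    rw [Fintype.card_set, Fintype.card_fin, logStar_two_pow (by omega)] at key
    have h5 : logStar 5 ≤ 4 := by
      rw [logStar_of_one_lt (by omega)]
      have h3 : Nat.clog 2 5 ≤ 3 := Nat.clog_le_of_le_pow (by norm_num)
      exact Nat.succ_le_succ ((logStar_mono h3).trans (logStar_le_self 3))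
    omega

end DistAlgorithm

end Cycle

/-! ### Colour reduction -/

/-- One step of Cole and Vishkin's colour reduction: the new colour of a node with colour `x` whose
parent has colour `y` consists of the lowest position in which the binary expansions of `x` and `y`
differ, and of the bit of `x` in this position. The value `0` for `x = y` is never used. -/
noncomputable def colorStep (x y : ℕ) : ℕ :=
  open Classical in
  if h : x ≠ y then 2 * Nat.find (Nat.exists_testBit_ne_of_ne h) +
    (x.testBit (Nat.find (Nat.exists_testBit_ne_of_ne h))).toNat else 0

theorem colorStep_spec {x y : ℕ} (h : x ≠ y) :
    ∃ i, x.testBit i ≠ y.testBit i ∧ colorStep x y = 2 * i + (x.testBit i).toNat := by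
  classical
  exact ⟨_, Nat.find_spec (Nat.exists_testBit_ne_of_ne h), by rw [colorStep, dif_pos h]⟩

theorem colorStep_ne {x y z : ℕ} (hxy : x ≠ y) (hyz : y ≠ z) :
    colorStep x y ≠ colorStep y z := by
  obtain ⟨i, hi, hx⟩ := colorStep_spec hxy
  obtain ⟨j, -, hy⟩ := colorStep_spec hyz
  rw [hx, hy]
  intro h
  have h1 := Bool.toNat_le (x.testBit i)
  have h2 := Bool.toNat_le (y.testBit j)
  obtain rfl : i = j := by omega
  apply hi
  have h3 : (x.testBit i).toNat = (y.testBit i).toNat := by omega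
  cases h4 : x.testBit i <;> cases h5 : y.testBit i <;> simp_all

theorem colorStep_lt {x y L : ℕ} (h : x ≠ y) (hx : x < 2 ^ L) (hy : y < 2 ^ L) :
    colorStep x y < 2 * L := by
  obtain ⟨i, hi, he⟩ := colorStep_spec h
  have h1 := Bool.toNat_le (x.testBit i)
  have hiL : i < L := by
    by_contra! hL
    have h2 := Nat.pow_le_pow_right two_pos hL
    exact hi (by
      rw [Nat.testBit_lt_two_pow (hx.trans_le h2), Nat.testBit_lt_two_pow (hy.trans_le h2)])
  omega

theorem two_mul_le_two_pow {L : ℕ} (hL : 1 ≤ L) : 2 * L ≤ 2 ^ L := by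
  induction L, hL using Nat.le_induction with
  | base => norm_num
  | succ L hL ih =>
    have := Nat.pow_le_pow_right two_pos hL
    rw [pow_succ]
    omega

/-- The bound `16 c (a + 1)` on the colours is inherited when `a` is replaced by `⌈log₂ a⌉`. -/
theorem two_mul_clog_le {c : ℕ} (hc : 1 ≤ c) (a : ℕ) :
    2 * Nat.clog 2 (16 * c * (a + 1)) ≤ 16 * c * (Nat.clog 2 a + 1) := by
  have h : Nat.clog 2 (16 * c * (a + 1)) ≤ 4 + c + (Nat.clog 2 a + 1) := by
    refine Nat.clog_le_of_le_pow ?_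
    rw [pow_add, pow_add, pow_succ 2 (Nat.clog 2 a)]
    have h1 := Nat.le_pow_clog one_lt_two a
    have h2 : 1 ≤ 2 ^ Nat.clog 2 a := Nat.one_le_two_pow
    exact Nat.mul_le_mul (Nat.mul_le_mul (by norm_num) Nat.lt_two_pow_self.le) (by omega)
  nlinarith [Nat.zero_le (Nat.clog 2 a), Nat.mul_le_mul hc (le_refl (Nat.clog 2 a))]

/-- The number with the given bits, the least significant one first. -/
def ofBitList (l : List Bool) : ℕ := l.foldr Nat.bit 0

theorem ofBitList_bits (n : ℕ) : ofBitList n.bits = n := by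
  induction n using Nat.binaryRec' with
  | zero => simp [ofBitList]
  | bit b n h ih =>
    rw [Nat.bits_append_bit n b h]
    exact congrArg (Nat.bit b) ih

/-! ### One phase of the matching algorithm -/

/-- One phase of the matching algorithm on the graph of a partial function `P` (the parent
relation) with a proper colouring. The matchings before the phase, after the nodes of colour `k`
have chosen a child, and at the end of the phase are `M₀`, `M₁` and `M₂`. A chosen child has not
chosen anyone in the same phase, since its colour is not `k`; so `M₂` is symmetric again. -/
theorem matching_phase {V : Type*} {P : V → V → Prop} {col : V → ℕ} {k : ℕ}
    {M₀ M₁ M₂ : V → Option V} (hcol : ∀ u w, P u w → col u ≠ col w)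
    (ha1 : ∀ v w, M₀ v = some w → M₁ v = some w)
    (ha2 : ∀ v w, M₀ v = none → M₁ v = some w → M₀ w = none ∧ P w v ∧ col v = k)
    (ha3 : ∀ v w, M₀ v = none → col v = k → P w v → M₀ w = none → M₁ v ≠ none)
    (hb1 : ∀ v w, M₁ v = some w → M₂ v = some w)
    (hb2 : ∀ u w, M₁ u = none → P u w → M₁ w = some u → M₂ u = some w)
    (hb3 : ∀ u w, M₁ u = none → M₂ u = some w → P u w ∧ M₁ w = some u)
    (hsymm : ∀ v w, M₀ v = some w → M₀ w = some v) :
    (∀ v w, M₂ v = some w → M₂ w = some v) ∧ (∀ v, M₀ v ≠ none → M₂ v ≠ none) ∧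
      ∀ u w, P u w → col w = k → M₂ u ≠ none ∨ M₂ w ≠ none := by
  have h1 : ∀ v, M₁ v ≠ none → M₂ v ≠ none := fun v h => by
    obtain ⟨w, hw⟩ := Option.ne_none_iff_exists'.1 h
    rw [hb1 v w hw]
    exact Option.some_ne_none w
  have h0 : ∀ v, M₀ v ≠ none → M₂ v ≠ none := fun v h => by
    obtain ⟨w, hw⟩ := Option.ne_none_iff_exists'.1 h
    rw [hb1 v w (ha1 v w hw)]
    exact Option.some_ne_none w
  refine ⟨fun v w h => ?_, h0, fun u w huw hk => ?_⟩
  · cases e1 : M₁ v with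
    | none =>
      exact hb1 w v (hb3 v w e1 h).2
    | some x =>
      obtain rfl : x = w := Option.some.inj ((hb1 v x e1).symm.trans h)
      cases e0 : M₀ v with
      | some y =>
        obtain rfl : y = x := Option.some.inj ((ha1 v y e0).symm.trans e1)
        exact hb1 y v (ha1 y v (hsymm v y e0))
      | none =>
        obtain ⟨hx, hP, hk⟩ := ha2 v x e0 e1
        refine hb2 x v ?_ hP e1
        by_contra hne
        obtain ⟨z, hz⟩ := Option.ne_none_iff_exists'.1 hne
        exact hcol x v hP ((ha2 x z hx hz).2.2.trans hk.symm)
  · by_contra! hcon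
    have hu : M₀ u = none := by
      by_contra h
      exact h0 u h hcon.1
    have hw : M₀ w = none := by
      by_contra h
      exact h0 w h hcon.2
    exact h1 w (ha3 w u hw hk huw hu) hcon.2

/-! ### The algorithm -/

/-- The state of a node: the number `n` of nodes of the network, the number of rounds so far, the
colour, and the port of the selected edge. -/
structure RulingState (d : ℕ) where
  n : ℕ
  time : ℕ
  color : ℕ
  mate : Option (Fin d)

/-- The number of rounds on networks with `n ≥ 1` nodes: `logStar n` rounds reduce the number of
colours to `32 c + 1`, and two rounds are spent on each of them. -/
def rulingDuration (c n : ℕ) : ℕ := logStar n + 2 * (32 * c + 1)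

open Classical in
/-- The algorithm. The parent of a node of positive degree is its neighbour behind port `0`. The
nodes send their colours while these are reduced. In the phase of the colour `k`, unmatched nodes
then propose to their parents, unmatched nodes of colour `k` choose a proposal, and they tell it to
the chosen child. In fact all matched nodes repeat this to their partners in each phase, which has no
effect on partners that are matched already. -/
noncomputable def rulingAlgorithm (c : ℕ) : DistAlgorithm where
  State := RulingState
  init n id _ := ⟨n, 0, id, none⟩
  send s i :=
    if s.time < logStar s.n then s.color.bits
    else if Even (s.time - logStar s.n) then if s.mate = none ∧ i.1 = 0 then [true] else []
    else if s.mate = some i then [true] else []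
  receive {d} s m :=
    { n := s.n
      time := s.time + 1
      color := if h : s.time < logStar s.n ∧ 0 < d then colorStep s.color (ofBitList (m ⟨0, h.2⟩))
        else s.color
      mate :=
        if s.time < logStar s.n then s.mate
        else if Even (s.time - logStar s.n) then
          if h : s.mate = none ∧ s.color = (s.time - logStar s.n) / 2 ∧ ∃ i, m i = [true] then
            some h.2.2.choose else s.mate
        else if h : s.mate = none ∧ ∃ h : 0 < d, m ⟨0, h⟩ = [true] then some ⟨0, h.2.1⟩
        else s.mate }
  output s :=
    if rulingDuration c s.n ≤ s.time then some fun i => decide (s.mate = some i) else none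

namespace Network

variable {n c : ℕ} (N : Network n c)

theorem nbr_injective (v : Fin n) : Function.Injective (N.nbr v) := fun _ _ h =>
  (N.port v).injective (Subtype.ext h)

theorem nbr_backPort (v : Fin n) (i : Fin (N.deg v)) : N.nbr (N.nbr v i) (N.backPort v i) = v :=
  congrArg Subtype.val ((N.port (N.nbr v i)).apply_symm_apply ⟨v, (N.adj_nbr v i).symm⟩)

theorem deg_nbr_pos (v : Fin n) (i : Fin (N.deg v)) : 0 < N.deg (N.nbr v i) :=
  (Nat.zero_le _).trans_lt (N.backPort v i).2

theorem exists_nbr_eq {v w : Fin n} (h : N.graph.Adj v w) : ∃ i, N.nbr v i = w :=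
  ⟨(N.port v).symm ⟨w, h⟩, congrArg Subtype.val ((N.port v).apply_symm_apply ⟨w, h⟩)⟩

/-- `w` is the neighbour of `v` behind port `0`. -/
def IsParent (v w : Fin n) : Prop := ∃ h : 0 < N.deg v, N.nbr v ⟨0, h⟩ = w

theorem val_backPort_eq_zero_iff (v : Fin n) (i : Fin (N.deg v)) :
    (N.backPort v i).1 = 0 ↔ N.IsParent (N.nbr v i) v := by
  constructor
  · intro h
    have e : (⟨0, N.deg_nbr_pos v i⟩ : Fin _) = N.backPort v i := Fin.ext h.symm
    exact ⟨N.deg_nbr_pos v i, by rw [e, nbr_backPort]⟩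
  · rintro ⟨h, hv⟩
    rw [← N.nbr_injective _ (hv.trans (N.nbr_backPort v i).symm)]

theorem eq_some_backPort_iff (v : Fin n) (i : Fin (N.deg v)) (o : Option (Fin (N.deg (N.nbr v i)))) :
    o = some (N.backPort v i) ↔ o.map (N.nbr (N.nbr v i)) = some v := by
  rw [← Option.map_injective (N.nbr_injective (N.nbr v i)) |>.eq_iff, Option.map_some, nbr_backPort]

end Network

namespace RulingAlgorithm

variable {n c : ℕ} (N : Network n c)

/-- The state of `v` after `t` rounds. -/
noncomputable abbrev state (t : ℕ) (v : Fin n) : RulingState (N.deg v) :=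
  (rulingAlgorithm c).exec N t v

theorem state_succ_eq_update (t : ℕ) (v : Fin n) : state N (t + 1) v =
    (rulingAlgorithm c).update (state N t v) fun i =>
      (rulingAlgorithm c).message (state N t (N.nbr v i)) (N.backPort v i) := rfl

theorem output_eq_none {d : ℕ} {s : RulingState d} (h : s.time < rulingDuration c s.n) :
    (rulingAlgorithm c).output s = none := if_neg (not_le.2 h)

theorem time_and_n {t : ℕ} (ht : t ≤ rulingDuration c n) (v : Fin n) :
    (state N t v).time = t ∧ (state N t v).n = n := by
  induction t with
  | zero => exact ⟨rfl, rfl⟩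
  | succ t ih =>
    obtain ⟨h1, h2⟩ := ih (by omega)
    have ho : (rulingAlgorithm c).output (state N t v) = none :=
      output_eq_none (by rw [h1, h2]; omega)
    rw [state_succ_eq_update, DistAlgorithm.update, ho]
    exact ⟨congrArg (· + 1) h1, h2⟩

theorem output_of_lt {t : ℕ} (ht : t < rulingDuration c n) (v : Fin n) :
    (rulingAlgorithm c).output (state N t v) = none := by
  obtain ⟨h1, h2⟩ := time_and_n N ht.le v
  exact output_eq_none (by rw [h1, h2]; exact ht)

open Classical in
theorem output_duration (v : Fin n) :
    (rulingAlgorithm c).output (state N (rulingDuration c n) v) =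
      some fun i => decide ((state N (rulingDuration c n) v).mate = some i) := by
  obtain ⟨h1, h2⟩ := time_and_n N le_rfl v
  exact if_pos (by rw [h1, h2])

theorem state_succ {t : ℕ} (ht : t < rulingDuration c n) (v : Fin n) : state N (t + 1) v =
    (rulingAlgorithm c).receive (state N t v) fun i =>
      (rulingAlgorithm c).send (state N t (N.nbr v i)) (N.backPort v i) := by
  rw [state_succ_eq_update, DistAlgorithm.update, output_of_lt N ht]
  simp only [DistAlgorithm.message, output_of_lt N ht]
  rfl

theorem lt_duration {t : ℕ} (ht : t < logStar n) : t < rulingDuration c n := by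
  unfold rulingDuration
  omega

theorem color_succ {t : ℕ} (ht : t < logStar n) {v : Fin n} (hv : 0 < N.deg v) :
    (state N (t + 1) v).color =
      colorStep (state N t v).color (state N t (N.nbr v ⟨0, hv⟩)).color := by
  obtain ⟨h1, h2⟩ := time_and_n N (lt_duration (c := c) ht).le v
  obtain ⟨h3, h4⟩ := time_and_n N (lt_duration (c := c) ht).le (N.nbr v ⟨0, hv⟩)
  rw [state_succ N (lt_duration ht)]
  simp only [rulingAlgorithm] at h1 h2 h3 h4 ⊢
  rw [dif_pos ⟨by rw [h1, h2]; exact ht, hv⟩, if_pos (by rw [h3, h4]; exact ht), ofBitList_bits]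

theorem color_succ_of_le {t : ℕ} (h : logStar n ≤ t) (ht : t < rulingDuration c n) (v : Fin n) :
    (state N (t + 1) v).color = (state N t v).color := by
  obtain ⟨h1, h2⟩ := time_and_n N ht.le v
  rw [state_succ N ht]
  simp only [rulingAlgorithm] at h1 h2 ⊢
  rw [dif_neg (by rw [h1, h2]; omega)]

theorem color_of_le {t : ℕ} (h : logStar n ≤ t) (ht : t ≤ rulingDuration c n) (v : Fin n) :
    (state N t v).color = (state N (logStar n) v).color := by
  induction t, h using Nat.le_induction with
  | base => rfl
  | succ t h ih => rw [color_succ_of_le N h ht, ih (by omega)]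

/-- The colours of a node and of its parent stay different during the colour reduction. -/
theorem color_ne {t : ℕ} (ht : t ≤ logStar n) {v : Fin n} (hv : 0 < N.deg v) :
    (state N t v).color ≠ (state N t (N.nbr v ⟨0, hv⟩)).color := by
  induction t generalizing v with
  | zero => exact N.id_injective.ne (N.adj_nbr v ⟨0, hv⟩).ne
  | succ t ih =>
    rw [color_succ N ht hv, color_succ N ht (N.deg_nbr_pos v ⟨0, hv⟩)]
    exact colorStep_ne (ih (by omega) hv) (ih (by omega) _)

theorem one_lt_of_deg_pos {v : Fin n} (hv : 0 < N.deg v) : 1 < n := by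
  have h := Fin.val_ne_of_ne (N.adj_nbr v ⟨0, hv⟩).ne
  have := v.2
  have := (N.nbr v ⟨0, hv⟩).2
  omega

theorem color_lt_two_pow (hc : 1 ≤ c) {t : ℕ} (ht : t ≤ logStar n) {v : Fin n}
    (hv : 0 < N.deg v) : (state N t v).color < 2 ^ (c * Nat.clog 2 n) := by
  induction t generalizing v with
  | zero => exact N.id_lt v
  | succ t ih =>
    rw [color_succ N ht hv]
    have h1 : 1 ≤ Nat.clog 2 n := Nat.clog_pos one_lt_two (one_lt_of_deg_pos N hv)
    exact (colorStep_lt (color_ne N (by omega) hv) (ih (by omega) hv)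
      (ih (by omega) (N.deg_nbr_pos v _))).trans_le (two_mul_le_two_pow (Nat.mul_pos hc h1))

/-- The colour bound in terms of the iterates of `⌈log₂ ·⌉` that define `logStar n`. -/
theorem color_lt_iterate (hc : 1 ≤ c) {t : ℕ} (ht : t + 1 ≤ logStar n) {v : Fin n}
    (hv : 0 < N.deg v) :
    (state N (t + 1) v).color < 16 * c * ((Nat.clog 2)^[t + 1] n + 1) := by
  induction t generalizing v with
  | zero =>
    rw [color_succ N ht hv]
    refine (colorStep_lt (color_ne N (by omega) hv) (N.id_lt v) (N.id_lt _)).trans_le ?_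
    simp only [zero_add, Function.iterate_one]
    nlinarith [Nat.zero_le (c * Nat.clog 2 n)]
  | succ t ih =>
    rw [color_succ N ht hv, Function.iterate_succ_apply']
    refine (colorStep_lt (color_ne N (by omega) hv) ?_ ?_).trans_le (two_mul_clog_le hc _)
    · exact (ih (by omega) hv).trans_le (Nat.le_pow_clog one_lt_two _)
    · exact (ih (by omega) (N.deg_nbr_pos v _)).trans_le (Nat.le_pow_clog one_lt_two _)

theorem color_logStar_lt (hc : 1 ≤ c) {v : Fin n} (hv : 0 < N.deg v) :
    (state N (logStar n) v).color < 32 * c + 1 := by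
  have h := logStar_of_one_lt (one_lt_of_deg_pos N hv)
  have h1 := color_lt_iterate N hc (t := logStar (Nat.clog 2 n)) h.ge hv
  rw [← h] at h1
  have h2 := clog_iterate_logStar_le_one n
  nlinarith [Nat.mul_le_mul (le_refl (16 * c)) h2]

/-- The partner of `v` after `t` rounds. -/
noncomputable def partner (t : ℕ) (v : Fin n) : Option (Fin n) :=
  (state N t v).mate.map (N.nbr v)

theorem partner_eq_none_iff {t : ℕ} {v : Fin n} :
    partner N t v = none ↔ (state N t v).mate = none := Option.map_eq_none_iff

theorem partner_of_le_logStar {t : ℕ} (ht : t ≤ logStar n) (v : Fin n) :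
    partner N t v = none := by
  rw [partner_eq_none_iff]
  induction t with
  | zero => rfl
  | succ t ih =>
    obtain ⟨h1, h2⟩ := time_and_n N (lt_duration (c := c) ht).le v
    have ih := ih (by omega)
    rw [state_succ N (lt_duration ht)]
    simp only [rulingAlgorithm] at h1 h2 ih ⊢
    rw [if_pos (by rw [h1, h2]; exact ht), ih]

/-- In a proposal round, `v` receives a proposal exactly from its unmatched children. -/
theorem send_even {t : ℕ} (h : logStar n ≤ t) (he : Even (t - logStar n))
    (ht : t < rulingDuration c n) (v : Fin n) (i : Fin (N.deg v)) :
    (rulingAlgorithm c).send (state N t (N.nbr v i)) (N.backPort v i) = [true] ↔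
      partner N t (N.nbr v i) = none ∧ N.IsParent (N.nbr v i) v := by
  obtain ⟨h1, h2⟩ := time_and_n N ht.le (N.nbr v i)
  rw [partner_eq_none_iff, ← N.val_backPort_eq_zero_iff]
  simp only [rulingAlgorithm] at h1 h2 ⊢
  rw [if_neg (by rw [h1, h2]; omega), if_pos (by rw [h1, h2]; exact he)]
  split_ifs with h3 <;> simp [h3]

/-- In an answer round, `v` receives an answer exactly from a node that regards `v` as its partner. -/
theorem send_odd {t : ℕ} (h : logStar n ≤ t) (he : ¬ Even (t - logStar n))
    (ht : t < rulingDuration c n) (v : Fin n) (i : Fin (N.deg v)) :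
    (rulingAlgorithm c).send (state N t (N.nbr v i)) (N.backPort v i) = [true] ↔
      partner N t (N.nbr v i) = some v := by
  obtain ⟨h1, h2⟩ := time_and_n N ht.le (N.nbr v i)
  rw [partner, ← N.eq_some_backPort_iff]
  simp only [rulingAlgorithm] at h1 h2 ⊢
  rw [if_neg (by rw [h1, h2]; omega), if_neg (by rw [h1, h2]; exact he)]
  split_ifs with h3 <;> simp [h3]

theorem mate_succ_even {t : ℕ} (h : logStar n ≤ t) (he : Even (t - logStar n))
    (ht : t < rulingDuration c n) (v : Fin n) :
    (∃ i, (state N (t + 1) v).mate = some i ∧ (state N t v).mate = none ∧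
      (state N t v).color = (t - logStar n) / 2 ∧
      partner N t (N.nbr v i) = none ∧ N.IsParent (N.nbr v i) v) ∨
    ((state N (t + 1) v).mate = (state N t v).mate ∧ ¬ ((state N t v).mate = none ∧
      (state N t v).color = (t - logStar n) / 2 ∧
      ∃ i, partner N t (N.nbr v i) = none ∧ N.IsParent (N.nbr v i) v)) := by
  obtain ⟨h1, h2⟩ := time_and_n N ht.le v
  simp only [← send_even N h he ht]
  rw [state_succ N ht]
  simp only [rulingAlgorithm] at h1 h2 ⊢
  rw [if_neg (by rw [h1, h2]; omega), if_pos (by rw [h1, h2]; exact he)]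
  have hk : ((state N t v).time - logStar (state N t v).n) / 2 = (t - logStar n) / 2 := by
    rw [h1, h2]
  split_ifs with h3
  · exact Or.inl ⟨_, rfl, h3.1, h3.2.1.trans hk, h3.2.2.choose_spec⟩
  · exact Or.inr ⟨rfl, fun h4 => h3 ⟨h4.1, h4.2.1.trans hk.symm, h4.2.2⟩⟩

theorem mate_succ_odd {t : ℕ} (h : logStar n ≤ t) (he : ¬ Even (t - logStar n))
    (ht : t < rulingDuration c n) (v : Fin n) :
    (∃ hv : 0 < N.deg v, (state N (t + 1) v).mate = some ⟨0, hv⟩ ∧ (state N t v).mate = none ∧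
      partner N t (N.nbr v ⟨0, hv⟩) = some v) ∨
    ((state N (t + 1) v).mate = (state N t v).mate ∧ ¬ ((state N t v).mate = none ∧
      ∃ hv : 0 < N.deg v, partner N t (N.nbr v ⟨0, hv⟩) = some v)) := by
  obtain ⟨h1, h2⟩ := time_and_n N ht.le v
  simp only [← send_odd N h he ht]
  rw [state_succ N ht]
  simp only [rulingAlgorithm] at h1 h2 ⊢
  rw [if_neg (by rw [h1, h2]; omega), if_neg (by rw [h1, h2]; exact he)]
  split_ifs with h3
  · exact Or.inl ⟨h3.2.1, rfl, h3.1, h3.2.2⟩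
  · exact Or.inr ⟨rfl, h3⟩

/-- After the phases of the colours below `k`, the matching is consistent, and each node whose
parent has a colour below `k` is matched or has a matched parent. -/
theorem partner_spec {k : ℕ} (hk : k ≤ 32 * c + 1) :
    (∀ v w, partner N (logStar n + 2 * k) v = some w →
      partner N (logStar n + 2 * k) w = some v) ∧
    ∀ u w, N.IsParent u w → (state N (logStar n) w).color < k →
      partner N (logStar n + 2 * k) u ≠ none ∨ partner N (logStar n + 2 * k) w ≠ none := by
  induction k with
  | zero =>
    refine ⟨fun v w h => ?_, fun u w _ h => absurd h (Nat.not_lt_zero _)⟩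
    rw [partner_of_le_logStar N (by omega)] at h
    exact absurd h (by simp)
  | succ k ih =>
    obtain ⟨ih1, ih2⟩ := ih (by omega)
    set t := logStar n + 2 * k with ht
    have hd : t + 1 < rulingDuration c n := by
      unfold rulingDuration
      omega
    have hL : logStar n ≤ t := by omega
    have heven : Even (t - logStar n) := ⟨k, by omega⟩
    have hodd : ¬ Even (t + 1 - logStar n) := by
      rw [show t + 1 - logStar n = 2 * k + 1 by omega]
      simp
    have hdiv : (t - logStar n) / 2 = k := by omega
    have hcol : ∀ v, (state N t v).color = (state N (logStar n) v).color :=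
      color_of_le N hL (by omega)
    obtain ⟨r1, r2, r3⟩ := matching_phase (P := N.IsParent) (k := k)
      (col := fun v => (state N (logStar n) v).color)
      (M₀ := partner N t) (M₁ := partner N (t + 1)) (M₂ := partner N (t + 1 + 1))
      (by
        rintro u w ⟨hu, rfl⟩
        exact color_ne N le_rfl hu)
      (by
        intro v w hv
        rcases mate_succ_even N hL heven (by omega) v with ⟨i, -, h0, -⟩ | ⟨h0, -⟩
        · rw [partner, h0] at hv
          exact absurd hv (by simp)
        · rw [partner, h0]
          exact hv)
      (by
        intro v w hv hw
        rcases mate_succ_even N hL heven (by omega) v with ⟨i, hi, -, hvk, h0, hp⟩ | ⟨h0, -⟩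
        · rw [partner, hi] at hw
          obtain rfl : N.nbr v i = w := Option.some.inj hw
          exact ⟨h0, hp, by rw [← hcol, hvk, hdiv]⟩
        · rw [partner, h0] at hw
          exact absurd (hv.symm.trans hw) (by simp))
      (by
        intro v w hv hvk hp hw
        rcases mate_succ_even N hL heven (by omega) v with ⟨i, hi, -⟩ | ⟨-, h0⟩
        · rw [partner, hi]
          simp
        · obtain ⟨i, rfl⟩ : ∃ i, N.nbr v i = w := by
            obtain ⟨hw0, rfl⟩ := hp
            exact ⟨_, N.nbr_backPort w ⟨0, hw0⟩⟩
          exact absurd ⟨(partner_eq_none_iff N).1 hv, by rw [hcol, hvk, hdiv], i, hw, hp⟩ h0)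
      (by
        intro v w hv
        rcases mate_succ_odd N (hL.trans t.le_succ) hodd hd v with ⟨i, -, h0, -⟩ | ⟨h0, -⟩
        · rw [partner, h0] at hv
          exact absurd hv (by simp)
        · rw [partner, h0]
          exact hv)
      (by
        rintro u w hu ⟨hu0, rfl⟩ hw
        rcases mate_succ_odd N (hL.trans t.le_succ) hodd hd u with ⟨i, hi, -⟩ | ⟨-, h0⟩
        · rw [partner, hi]
          rfl
        · exact absurd ⟨(partner_eq_none_iff N).1 hu, hu0, hw⟩ h0)
      (by
        intro u w hu hw
        rcases mate_succ_odd N (hL.trans t.le_succ) hodd hd u with ⟨i, hi, -, h0⟩ | ⟨h0, -⟩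
        · rw [partner, hi] at hw
          obtain rfl : N.nbr u ⟨0, i⟩ = w := Option.some.inj hw
          exact ⟨⟨i, rfl⟩, h0⟩
        · rw [partner, h0] at hw
          exact absurd (hu.symm.trans hw) (by simp))
      ih1
    have e : logStar n + 2 * (k + 1) = t + 1 + 1 := by omega
    rw [e]
    refine ⟨r1, fun u w huw hw => ?_⟩
    rcases Nat.lt_succ_iff_lt_or_eq.1 hw with h | h
    · exact (ih2 u w huw h).imp (r2 u) (r2 w)
    · exact r3 u w huw h

end RulingAlgorithm

/-! ### Correctness, message size and round complexity of the algorithm -/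

/-- A matching `M` is a 2-ruling edge set if each node of positive degree is matched or has a
matched neighbour: the edge from a node `u` to such a neighbour `w` is adjacent to each edge at
`u`, and it shares a node with an edge of the matching. -/
theorem isRulingEdgeSet_of_matching {V : Type*} {G : SimpleGraph V} {M : V → Option V}
    (hsymm : ∀ v w, M v = some w → M w = some v)
    (hadj : ∀ v w, M v = some w → G.Adj v w)
    (hdom : ∀ v w, G.Adj v w → ∃ u, G.Adj v u ∧ (M v ≠ none ∨ M u ≠ none)) :
    IsRulingEdgeSet G 2 2 {e | ∃ v w, M v = some w ∧ e.1 = s(v, w)} := by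
  have hmem : ∀ e : G.edgeSet, (∃ v w, M v = some w ∧ e.1 = s(v, w)) → ∀ x ∈ e.1,
      ∃ y, M x = some y ∧ e.1 = s(x, y) := by
    rintro e ⟨v, w, hvw, he⟩ x hx
    rw [he] at hx
    rcases Sym2.mem_iff.1 hx with rfl | rfl
    · exact ⟨w, hvw, he⟩
    · exact ⟨v, hsymm _ _ hvw, he.trans Sym2.eq_swap⟩
  refine ⟨fun e he f hf hne => ?_, fun e _ => ?_⟩
  · by_contra! hlt
    have h1 : G.lineGraph.edist e f ≤ 1 := by simpa using hlt
    have hadj' : G.lineGraph.Adj e f := by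
      rw [← SimpleGraph.edist_eq_one_iff_adj]
      refine le_antisymm h1 (Order.one_le_iff_pos.2 (pos_iff_ne_zero.2 fun h0 => ?_))
      exact hne (SimpleGraph.edist_eq_zero_iff.1 h0)
    obtain ⟨-, x, hxe, hxf⟩ := SimpleGraph.lineGraph_adj_iff_exists.1 hadj'
    obtain ⟨y, hy, hey⟩ := hmem e he x hxe
    obtain ⟨z, hz, hfz⟩ := hmem f hf x hxf
    obtain rfl : y = z := Option.some.inj (hy.symm.trans hz)
    exact hne (Subtype.ext (hey.trans hfz.symm))
  · obtain ⟨e, he⟩ := e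
    induction e using Sym2.ind with
    | _ v w =>
      obtain ⟨u, hu, hM⟩ := hdom v w he
      obtain ⟨x, hx, hMx⟩ : ∃ x ∈ s(v, u), M x ≠ none := by
        rcases hM with h | h
        · exact ⟨v, Sym2.mem_mk_left v u, h⟩
        · exact ⟨u, Sym2.mem_mk_right v u, h⟩
      obtain ⟨y, hy⟩ := Option.ne_none_iff_exists'.1 hMx
      refine ⟨⟨s(x, y), hadj x y hy⟩, ⟨x, y, hy, rfl⟩, ?_⟩
      have h1 := SimpleGraph.edist_lineGraph_le_one (e := (⟨s(v, w), he⟩ : G.edgeSet))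
        (f := ⟨s(v, u), hu⟩) (Sym2.mem_mk_left v w) (Sym2.mem_mk_left v u)
      have h2 := SimpleGraph.edist_lineGraph_le_one (e := (⟨s(v, u), hu⟩ : G.edgeSet))
        (f := ⟨s(x, y), hadj x y hy⟩) hx (Sym2.mem_mk_left x y)
      exact (SimpleGraph.edist_triangle.trans (add_le_add h1 h2)).trans (by norm_num)

theorem rulingAlgorithm_computesRulingEdgeSet {c : ℕ} (hc : 1 ≤ c) :
    (rulingAlgorithm c).ComputesRulingEdgeSet c 2 2 := by
  intro n N
  obtain ⟨h1, h2⟩ := RulingAlgorithm.partner_spec N le_rfl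
  have hT : logStar n + 2 * (32 * c + 1) = rulingDuration c n := rfl
  rw [hT] at h1 h2
  refine ⟨rulingDuration c n, _, isRulingEdgeSet_of_matching h1 (fun v w h => ?_)
    (fun v w h => ?_), fun v => ⟨_, RulingAlgorithm.output_duration N v, fun i => ?_⟩⟩
  · obtain ⟨i, -, rfl⟩ := Option.map_eq_some_iff.1 h
    exact N.adj_nbr v i
  · obtain ⟨i, -⟩ := N.exists_nbr_eq h
    have hv : 0 < N.deg v := (Nat.zero_le _).trans_lt i.2
    exact ⟨N.nbr v ⟨0, hv⟩, N.adj_nbr v _, h2 _ _ ⟨hv, rfl⟩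
      (RulingAlgorithm.color_logStar_lt N hc (N.deg_nbr_pos v _))⟩
  · rw [decide_eq_true_iff]
    constructor
    · intro hi
      exact ⟨v, N.nbr v i, Option.map_eq_some_iff.2 ⟨i, hi, rfl⟩, rfl⟩
    · rintro ⟨u, w, huw, he⟩
      have hv : RulingAlgorithm.partner N (rulingDuration c n) v = some (N.nbr v i) := by
        rcases Sym2.eq_iff.1 he with ⟨hu, hw⟩ | ⟨hu, hw⟩
        · exact (hu ▸ huw).trans (congrArg some hw.symm)
        · exact (hu ▸ h1 u w huw).trans (congrArg some hw.symm)
      obtain ⟨j, hj, hji⟩ := Option.map_eq_some_iff.1 hv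
      rwa [N.nbr_injective v hji] at hj

theorem RulingAlgorithm.length_send_le (c : ℕ) {d B : ℕ} (hB : 1 ≤ B) {s : RulingState d}
    (hs : s.time < logStar s.n → s.color < 2 ^ B) (i : Fin d) :
    ((rulingAlgorithm c).send s i).length ≤ B := by
  simp only [rulingAlgorithm]
  split_ifs with h
  · rw [Nat.size_eq_bits_len, Nat.size_le]
    exact hs h
  all_goals simp only [List.length_cons, List.length_nil, Nat.zero_le, zero_add, hB]

theorem rulingAlgorithm_isCongest {c : ℕ} (hc : 1 ≤ c) : (rulingAlgorithm c).IsCongest c := by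
  refine ⟨c, fun n N t v i => ?_⟩
  have hv : 0 < N.deg v := (Nat.zero_le _).trans_lt i.2
  have hn := RulingAlgorithm.one_lt_of_deg_pos N hv
  have hpos : 1 ≤ c * Nat.clog 2 n := Nat.mul_pos hc (Nat.clog_pos one_lt_two hn)
  rcases Nat.lt_or_ge t (rulingDuration c n) with ht | ht
  · obtain ⟨h1, h2⟩ := RulingAlgorithm.time_and_n N ht.le v
    rw [DistAlgorithm.message, RulingAlgorithm.output_of_lt N ht]
    refine RulingAlgorithm.length_send_le c hpos (fun h => ?_) i
    exact RulingAlgorithm.color_lt_two_pow N hc (by rw [h1, h2] at h; exact h.le) hv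
  · have ho : ((rulingAlgorithm c).output
        ((rulingAlgorithm c).exec N (rulingDuration c n) v)).isSome := by
      rw [RulingAlgorithm.output_duration N v]
      rfl
    obtain ⟨s, rfl⟩ := Nat.exists_eq_add_of_le ht
    rw [DistAlgorithm.message, DistAlgorithm.exec_add_of_isSome _ N ho, if_pos ho]
    exact Nat.zero_le _

/-- The network without edges in which each node is its own identifier. -/
def emptyNetwork (n c : ℕ) (hc : 1 ≤ c) : Network n c where
  graph := ⊥
  id v := v
  id_injective := Fin.val_injective
  id_lt v := v.2.trans_le ((Nat.le_pow_clog one_lt_two n).trans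
    (Nat.pow_le_pow_right two_pos (Nat.le_mul_of_pos_left _ hc)))
  deg _ := 0
  port _ := ⟨fun i => i.elim0, fun w => w.2.elim, fun i => i.elim0, fun w => w.2.elim⟩

theorem rulingAlgorithm_hasRoundComplexity {c : ℕ} (hc : 1 ≤ c) :
    (rulingAlgorithm c).HasRoundComplexity c fun n => if n = 0 then 0 else rulingDuration c n := by
  intro n
  rcases Nat.eq_zero_or_pos n with rfl | hn
  · exact ⟨fun N v => v.elim0, fun t _ => Nat.zero_le t⟩
  · simp only [if_neg hn.ne']
    refine ⟨fun N v => by rw [RulingAlgorithm.output_duration N v]; rfl, fun t ht => ?_⟩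
    by_contra! hlt
    have h := ht (emptyNetwork n c hc) ⟨0, hn⟩
    rw [RulingAlgorithm.output_of_lt _ hlt] at h
    exact absurd h (by simp)

/-! ### Asymptotics of the round complexity -/

theorem mainTheorem1 (c : ℕ) (hc : 1 ≤ c) :
    (∃ (A : DistAlgorithm) (T : ℕ → ℕ),
      A.IsCongest c ∧ A.ComputesRulingEdgeSet c 2 2 ∧ A.HasRoundComplexity c T ∧
        (fun n => (T n : ℝ)) =Θ[atTop] (fun n => (logStar n : ℝ))) ∧
    (∀ (A : DistAlgorithm) (T : ℕ → ℕ),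
      A.IsCongest c → A.ComputesRulingEdgeSet c 2 2 → A.HasRoundComplexity c T →
        (fun n => (logStar n : ℝ)) =O[atTop] (fun n => (T n : ℝ))) := by
  have lower : ∀ (A : DistAlgorithm) (T : ℕ → ℕ), A.ComputesRulingEdgeSet c 2 2 →
      A.HasRoundComplexity c T → (fun n => (logStar n : ℝ)) =O[atTop] (fun n => (T n : ℝ)) := by
    intro A T hA hT
    refine IsBigO.of_bound 11 ?_
    filter_upwards [tendsto_logStar.eventually_ge_atTop 10] with n hn
    have h := A.logStar_le_of_haltsBy hc hA (hT n).1
    -- `logStar n ≥ 10` excludes `T n = 0`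
    have h' : logStar n ≤ 11 * T n := by omega
    rw [Real.norm_natCast, Real.norm_natCast]
    exact_mod_cast h'
  refine ⟨⟨rulingAlgorithm c, _, rulingAlgorithm_isCongest hc,
    rulingAlgorithm_computesRulingEdgeSet hc, rulingAlgorithm_hasRoundComplexity hc, ?_,
    lower _ _ (rulingAlgorithm_computesRulingEdgeSet hc) (rulingAlgorithm_hasRoundComplexity hc)⟩,
    fun A T _ => lower A T⟩
  refine IsBigO.of_bound ((64 * c + 3 : ℕ) : ℝ) ?_
  filter_upwards [tendsto_logStar.eventually_ge_atTop 1] with n hn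
  rw [Real.norm_natCast, Real.norm_natCast]
  have h : (if n = 0 then 0 else rulingDuration c n) ≤ (64 * c + 3) * logStar n := by
    split_ifs
    · exact Nat.zero_le _
    · unfold rulingDuration
      nlinarith [Nat.mul_le_mul (le_refl (64 * c + 2)) hn]
  exact_mod_cast h
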